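/- Let $S=(\mathbb N,\cdot)$ be the semigroup of natural numbers $\{1,2,3,\dots\}$ under multiplication. Let $\ell^1(S)$ be its (complex) semigroup algebra with the convolution product determined by $\delta_s\delta_t=\delta_{st}$, and let $\Gamma:\ell^1(S)\to\ell^1(S\times S)$ be the coproduct, the bounded linear map with $\Gamma(\delta_s)=\delta_{(s,s)}$. A \emph{predual} of $\ell^1(S)$ is a norm closed subspace $E\subseteq\ell^\infty(S)=\ell^1(S)^*$ such that the canonical map $\ell^1(S)\to E^*$, $a\mapsto(f\mapsto\langle f,a\rangle)$, is an isomorphism of Banach spaces. A predual $E$ is a \emph{Hopf algebra predual} if the product of $\ell^1(S)$ is separately weak$^*$-continuous and $\Gamma$ is weak$^*$-continuous, where $\ell^1(S)$ carries the topology $\sigma(\ell^1(S),E)$ and $\ell^1(S\times S)$ carries the weak$^*$ topology induced by the closed linear span in $\ell^\infty(S\times S)$ of the functions $(s,t)\mapsto f(s)g(t)$ with $f,g\in E$. (Equivalently, $E$ is an $\ell^1(S)$-submodule and a subalgebra of $\ell^\infty(S)$.) Then there exist a continuum of distinct Hopf algebra preduals of $\ell^1(\mathbb N,\cdot)$: there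 is a set of cardinality $2^{\aleph_0}$ of subspaces of $\ell^\infty(\mathbb N)$, each of which is a Hopf algebra predual of $\ell^1(\mathbb N,\cdot)$. -/

import Mathlib

open scoped ENNReal Cardinal Topology

namespace SemigroupPredual

/-- The Banach space `ℓ¹(S)`. -/
abbrev L1 (S : Type*) : Type _ := lp (fun _ : S => ℂ) 1

/-- The Banach algebra `ℓ^∞(S)` of bounded functions, with pointwise product. -/
abbrev LInf (S : Type*) : Type _ := lp (fun _ : S => ℂ) ∞

/-- The dual pairing `⟨f, a⟩ = ∑ₛ f s * a s` between `ℓ^∞(S)` and `ℓ¹(S)`, which identifies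
`ℓ^∞(S)` with the dual of `ℓ¹(S)`. -/
noncomputable def pairing (S : Type*) : LInf S →L[ℂ] L1 S →L[ℂ] ℂ :=
  lp.dualPairing ∞ 1 (fun _ : S => ContinuousLinearMap.mul ℂ ℂ) (K := 1)
    (fun _ => ContinuousLinearMap.opNorm_mul_le ℂ ℂ)

theorem pairing_apply {S : Type*} (f : LInf S) (a : L1 S) :
    pairing S f a = ∑' s, f s * a s := rfl

theorem summable_norm {S : Type*} (a : L1 S) : Summable fun s => ‖a s‖ := by
  simpa using (lp.memℓp a).summable (by simp)

section Algebra

variable {S : Type*} [DecidableEq S]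

/-- The unit vector `δ_s` of `ℓ¹(S)`. -/
noncomputable def delta (s : S) : L1 S := lp.single 1 s (1 : ℂ)

theorem norm_delta (s : S) : ‖delta s‖ = 1 := by
  simp [delta]

/-- The convolution product `a * b = ∑_{s,t} a_s b_t δ_{st}` of `ℓ¹(S)`
(a norm convergent sum). -/
noncomputable def conv [Mul S] (a b : L1 S) : L1 S :=
  ∑' p : S × S, (a p.1 * b p.2) • delta (p.1 * p.2)

theorem summable_conv [Mul S] (a b : L1 S) :
    Summable fun p : S × S => (a p.1 * b p.2) • delta (p.1 * p.2) := by
  refine Summable.of_norm ?_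
  simpa [norm_smul, norm_delta] using
    (summable_norm a).mul_of_nonneg (summable_norm b) (fun _ => norm_nonneg _)
      (fun _ => norm_nonneg _)

/-- The coproduct `Γ : ℓ¹(S) → ℓ¹(S × S)`, `Γ(∑ a_s δ_s) = ∑ a_s δ_{(s,s)}`
(a norm convergent sum). -/
noncomputable def coproduct (a : L1 S) : L1 (S × S) :=
  ∑' s : S, a s • delta (s, s)

theorem summable_coproduct (a : L1 S) :
    Summable fun s : S => a s • delta (s, s) := by
  refine Summable.of_norm ?_
  simpa [norm_smul, norm_delta] using summable_norm a

end Algebra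

variable {S : Type*}

/-- `E ⊆ ℓ^∞(S) = ℓ¹(S)^*` is a Banach space predual of `ℓ¹(S)`: it is norm closed and the
canonical bounded linear map `ℓ¹(S) → E^*`, `a ↦ (f ↦ ⟨f, a⟩)`, is a bijection
(hence an isomorphism of Banach spaces). -/
def IsBanachPredual (E : Submodule ℂ (LInf S)) : Prop :=
  IsClosed (E : Set (LInf S)) ∧
    Function.Bijective fun a : L1 S => ((pairing S).flip a).comp E.subtypeL

/-- The topology `σ(ℓ¹(S), E)`; it is the weak* topology on `ℓ¹(S)` when `E` is a predual. -/
noncomputable abbrev weakStar (E : Submodule ℂ (LInf S)) : TopologicalSpace (L1 S) :=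
  TopologicalSpace.induced (fun (a : L1 S) (f : E) => pairing S f a) inferInstance

/-- The closed linear span in `ℓ^∞(S × S)` of the functions `(s, t) ↦ f s * g t`, `f, g ∈ E`
(the injective tensor square of `E`): the subspace that induces the weak* topology on
`ℓ¹(S × S) = ℓ¹(S) ⊗ ℓ¹(S)`. -/
noncomputable def tensorSquare (E : Submodule ℂ (LInf S)) : Submodule ℂ (LInf (S × S)) :=
  (Submodule.span ℂ
    {F : LInf (S × S) | ∃ f ∈ E, ∃ g ∈ E, ∀ s t, F (s, t) = f s * g t}).topologicalClosure

/-- `E ⊆ ℓ^∞(S)` is a Hopf algebra predual of `ℓ¹(S)`: a Banach space predual for which the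
product of `ℓ¹(S)` is separately weak*-continuous (i.e. `E` is an `ℓ¹(S)`-submodule of `ℓ^∞(S)`)
and the coproduct is weak*-continuous (i.e. `E` is a subalgebra of `ℓ^∞(S)`). -/
structure IsHopfPredual [DecidableEq S] [Semigroup S] (E : Submodule ℂ (LInf S)) : Prop where
  isBanachPredual : IsBanachPredual E
  continuous_conv_left : ∀ b : L1 S, Continuous[weakStar E, weakStar E] fun a => conv b a
  continuous_conv_right : ∀ b : L1 S, Continuous[weakStar E, weakStar E] fun a => conv a b
  continuous_coproduct :
    Continuous[weakStar E, weakStar (tensorSquare E)] (coproduct : L1 S → L1 (S × S))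

end SemigroupPredual

/-! For a set `A` of primes let `r k` be the endomorphism of (ℕ, ·) that turns every prime factor in
`A` beyond `k` into 2. The indicators of the fibres of the `r k` ("cells") span a closed space that
makes the primes of `A` converge to 2. Cells are nested or disjoint, and a translate of a cell is a
cell or zero, so the space is a subalgebra and a submodule.

It is a predual because a functional on it has only point masses: its values on the cells over `s`
converge to some `z s`, with `z` in ℓ¹ (`exists_tendsto_cell`). What remains has no point masses and
vanishes by induction on the exponent of 2 (`eq_zero_of_tendsto_cell`).

The space remembers `A` up to finite sets (`finite_diff_of_space_le`), which leaves a continuum of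
distinct spaces. -/

namespace SemigroupPredual

/-! ### Weak*-continuity through adjoints -/

section Pullback

variable {S T : Type*}

/-- The pullback `f ↦ f ∘ g` of bounded functions along a map `g`. -/
noncomputable def pullback (g : S → T) : LInf T →L[ℂ] LInf S :=
  LinearMap.mkContinuous
    { toFun := fun f => ⟨fun s => f (g s), memℓp_infty ⟨‖f‖, by
        rintro _ ⟨s, rfl⟩
        exact lp.norm_apply_le_norm (by simp) f (g s)⟩⟩
      map_add' := fun _ _ => rfl
      map_smul' := fun _ _ => rfl } 1 fun f => by
    rw [one_mul]
    exact lp.norm_le_of_forall_le (norm_nonneg _)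
      fun s => lp.norm_apply_le_norm (by simp) f (g s)

@[simp]
theorem pullback_apply (g : S → T) (f : LInf T) (s : S) : pullback g f s = f (g s) := rfl

theorem norm_pullback_le (g : S → T) (f : LInf T) : ‖pullback g f‖ ≤ ‖f‖ :=
  lp.norm_le_of_forall_le (norm_nonneg _) fun s => lp.norm_apply_le_norm (by simp) f (g s)

/-- A map `ℓ¹(S) → ℓ¹(T)` is weak*-continuous if its formal adjoint maps `F` into `E`. -/
theorem continuous_weakStar (E : Submodule ℂ (LInf S)) (F : Submodule ℂ (LInf T))
    (u : L1 S → L1 T) (h : ∀ f ∈ F, ∃ g ∈ E, ∀ a, pairing T f (u a) = pairing S g a) :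
    Continuous[weakStar E, weakStar F] u := by
  let := weakStar E
  refine continuous_induced_rng.2 (continuous_pi fun f => ?_)
  obtain ⟨g, hg, hgu⟩ := h f f.2
  have : (fun a => pairing T f (u a)) = (fun φ : E → ℂ => φ ⟨g, hg⟩) ∘
      fun (a : L1 S) (f : E) => pairing S f a := funext hgu
  exact this ▸ (continuous_apply _).comp continuous_induced_dom

theorem _root_.Submodule.map_mem_topologicalClosure_span {V W : Type*}
    [NormedAddCommGroup V] [NormedSpace ℂ V] [NormedAddCommGroup W] [NormedSpace ℂ W]
    (u : V →L[ℂ] W) {s : Set V} {F : Submodule ℂ W} (hF : IsClosed (F : Set W))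
    (h : ∀ x ∈ s, u x ∈ F) {x : V} (hx : x ∈ (Submodule.span ℂ s).topologicalClosure) :
    u x ∈ F := by
  have : (Submodule.span ℂ s).topologicalClosure ≤ F.comap (u : V →ₗ[ℂ] W) :=
    Submodule.topologicalClosure_minimal _ (Submodule.span_le.2 h) (hF.preimage u.continuous)
  exact this hx

/-- The module action of `ℓ¹(S)` on `ℓ^∞(S)` dual to convolution. -/
noncomputable def act [Mul S] (b : L1 S) (f : LInf S) : LInf S :=
  ∑' t, b t • pullback (t * ·) f

theorem summable_act [Mul S] (b : L1 S) (f : LInf S) :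
    Summable fun t => b t • pullback (t * ·) f := by
  refine Summable.of_norm_bounded ((summable_norm b).mul_right ‖f‖) fun t => ?_
  rw [norm_smul]
  gcongr
  exact norm_pullback_le _ f

end Pullback

section Convolution

variable {S : Type*} [DecidableEq S]

theorem pairing_delta (f : LInf S) (s : S) : pairing S f (delta s) = f s := by
  rw [pairing_apply, tsum_eq_single s]
  · simp [delta]
  · intro t ht
    simp [delta, Pi.single_eq_of_ne ht]

theorem pairing_coproduct (f : LInf (S × S)) (a : L1 S) :
    pairing (S × S) f (coproduct a) = pairing S (pullback (fun s => (s, s)) f) a := by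
  rw [coproduct, ContinuousLinearMap.map_tsum _ (summable_coproduct a), pairing_apply]
  refine tsum_congr fun s => ?_
  rw [map_smul, pairing_delta, pullback_apply, smul_eq_mul, mul_comm]

theorem conv_comm [CommSemigroup S] (a b : L1 S) : conv a b = conv b a := by
  rw [conv, conv, ← (Equiv.prodComm S S).tsum_eq]
  refine tsum_congr fun p => ?_
  simp [mul_comm]

theorem pairing_conv [Mul S] (f : LInf S) (a b : L1 S) :
    pairing S f (conv b a) = pairing S (act b f) a := by
  have h := (summable_conv b a).mapL (pairing S f)
  rw [conv, ContinuousLinearMap.map_tsum _ (summable_conv b a), h.tsum_prod, act,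
    ← ContinuousLinearMap.flip_apply, ContinuousLinearMap.map_tsum _ (summable_act b f)]
  refine tsum_congr fun t => ?_
  rw [map_smul, ContinuousLinearMap.flip_apply, pairing_apply, smul_eq_mul, ← tsum_mul_left]
  refine tsum_congr fun s => ?_
  rw [map_smul, pairing_delta, pullback_apply, smul_eq_mul]
  ring

/-- A Banach predual of the algebra of a commutative semigroup is a Hopf algebra predual as soon
as it is invariant under translations and closed under products. -/
theorem IsBanachPredual.isHopfPredual [CommSemigroup S] {E : Submodule ℂ (LInf S)}
    (hE : IsBanachPredual E) (htrans : ∀ t, ∀ f ∈ E, pullback (t * ·) f ∈ E)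
    (hmul : ∀ f ∈ E, ∀ g ∈ E, f * g ∈ E) : IsHopfPredual E := by
  have hconv (b : L1 S) : Continuous[weakStar E, weakStar E] fun a => conv b a := by
    refine continuous_weakStar E E _ fun f hf => ⟨act b f, ?_, fun a => pairing_conv f a b⟩
    -- Norm closedness of `E` passes from translates to the infinite combination `act b f`.
    exact hE.1.mem_of_tendsto (summable_act b f).hasSum
      (Filter.Eventually.of_forall fun s => E.sum_mem fun t _ => E.smul_mem _ (htrans t f hf))
  refine ⟨hE, hconv, fun b => ?_, ?_⟩
  · simpa only [conv_comm b] using hconv b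
  · refine continuous_weakStar E _ _ fun F hF =>
      ⟨pullback (fun s => (s, s)) F, ?_, pairing_coproduct F⟩
    refine Submodule.map_mem_topologicalClosure_span _ hE.1 ?_ hF
    rintro F ⟨f, hf, g, hg, hF⟩
    convert hmul f hf g hg
    ext s
    simp [hF]

end Convolution

/-! ### Functionals on subspaces of ℓ^∞ -/

theorem _root_.ContinuousLinearMap.exists_sum_norm_apply_le {V ι : Type*}
    [NormedAddCommGroup V] [NormedSpace ℂ V] (φ : V →L[ℂ] ℂ) (F : Finset ι) (g : ι → V) :
    ∃ c : ι → ℂ, (∀ i, ‖c i‖ ≤ 1) ∧ ∑ i ∈ F, ‖φ (g i)‖ ≤ ‖φ‖ * ‖∑ i ∈ F, c i • g i‖ := by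
  have hc (z : ℂ) : ∃ c : ℂ, ‖c‖ ≤ 1 ∧ c * z = ‖z‖ := by
    rcases eq_or_ne z 0 with rfl | hz
    · exact ⟨0, by simp⟩
    · refine ⟨‖z‖ / z, ?_, div_mul_cancel₀ _ hz⟩
      simp [hz]
  choose c hc1 hc2 using hc
  refine ⟨fun i => c (φ (g i)), fun i => hc1 _, ?_⟩
  have hsum : φ (∑ i ∈ F, c (φ (g i)) • g i) = ((∑ i ∈ F, ‖φ (g i)‖ : ℝ) : ℂ) := by
    simp [hc2]
  calc ∑ i ∈ F, ‖φ (g i)‖ = ‖φ (∑ i ∈ F, c (φ (g i)) • g i)‖ := by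
        rw [hsum, Complex.norm_real, Real.norm_of_nonneg]
        positivity
    _ ≤ ‖φ‖ * ‖∑ i ∈ F, c (φ (g i)) • g i‖ := φ.le_opNorm _

/-- A bounded functional on a subspace of `ℓ^∞(S)` is small on families of functions which are
absolutely summable with sum at most one at every point. -/
theorem sum_norm_apply_le {S ι : Type*} {E : Submodule ℂ (LInf S)} (φ : E →L[ℂ] ℂ)
    (F : Finset ι) (g : ι → E) (hg : ∀ x, ∑ i ∈ F, ‖(g i : LInf S) x‖ ≤ 1) :
    ∑ i ∈ F, ‖φ (g i)‖ ≤ ‖φ‖ := by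
  obtain ⟨c, hc, hsum⟩ := φ.exists_sum_norm_apply_le F g
  refine hsum.trans (mul_le_of_le_one_right φ.opNorm_nonneg ?_)
  have hcoe : ((∑ i ∈ F, c i • g i : E) : LInf S) = ∑ i ∈ F, c i • (g i : LInf S) :=
    map_sum E.subtype _ F
  rw [Submodule.coe_norm, hcoe]
  refine lp.norm_le_of_forall_le zero_le_one fun x => ?_
  rw [lp.coeFn_sum, Finset.sum_apply]
  refine (norm_sum_le _ _).trans ((Finset.sum_le_sum fun i _ => ?_).trans (hg x))
  simpa using mul_le_of_le_one_left (norm_nonneg ((g i : LInf S) x)) (hc i)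

/-! ### The predual of a retraction tower -/

/-- A commuting sequence of retractive endomorphisms of a semigroup, increasing to the identity,
with finite fibres between consecutive images, and such that every element which is moved
increases its rank. -/
structure RetractionTower (S : Type*) [Mul S] where
  /-- The retractions. -/
  r : ℕ → S → S
  map_mul : ∀ k x y, r k (x * y) = r k x * r k y
  r_r_of_le : ∀ {k l} x, k ≤ l → r k (r l x) = r k x
  r_r_of_ge : ∀ {k l} x, k ≤ l → r l (r k x) = r k x
  exists_fixed : ∀ x, ∃ k, r k x = x
  /-- The rank of an element. -/
  rank : S → ℕ
  rank_lt : ∀ k x, r k x ≠ x → rank x < rank (r k x)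
  finite_fiber : ∀ k s, {t | r k t = s ∧ r (k + 1) t = t}.Finite

namespace RetractionTower

variable {S : Type*} [Mul S] (R : RetractionTower S)

theorem r_eq_self_of_le {k l : ℕ} {x : S} (h : R.r k x = x) (hkl : k ≤ l) : R.r l x = x := by
  rw [← h, R.r_r_of_ge x hkl]

theorem eventually_r_eq_self (x : S) : ∀ᶠ k in Filter.atTop, R.r k x = x := by
  obtain ⟨k, hk⟩ := R.exists_fixed x
  exact Filter.eventually_atTop.2 ⟨k, fun l hl => R.r_eq_self_of_le hk hl⟩

variable [DecidableEq S]

/-- The indicator function of the fibre of the `k`-th retraction over `s`. -/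
noncomputable def cell (k : ℕ) (s : S) : LInf S :=
  ⟨fun x => if R.r k x = s then 1 else 0, memℓp_infty ⟨1, by
    rintro _ ⟨x, rfl⟩
    dsimp only
    split_ifs <;> simp⟩⟩

theorem cell_apply (k : ℕ) (s x : S) : R.cell k s x = if R.r k x = s then 1 else 0 := rfl

/-- The closed linear span of the indicator functions of the fibres. -/
noncomputable def space : Submodule ℂ (LInf S) :=
  (Submodule.span ℂ (Set.range fun p : ℕ × S => R.cell p.1 p.2)).topologicalClosure

theorem isClosed_space : IsClosed (R.space : Set (LInf S)) :=
  Submodule.isClosed_topologicalClosure _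

theorem cell_mem_space (k : ℕ) (s : S) : R.cell k s ∈ R.space :=
  Submodule.le_topologicalClosure _ (Submodule.subset_span ⟨(k, s), rfl⟩)

theorem map_mem_of_mem_space {W : Type*} [NormedAddCommGroup W] [NormedSpace ℂ W]
    (u : LInf S →L[ℂ] W) {F : Submodule ℂ W} (hF : IsClosed (F : Set W))
    (h : ∀ k s, u (R.cell k s) ∈ F) {f : LInf S} (hf : f ∈ R.space) : u f ∈ F :=
  Submodule.map_mem_topologicalClosure_span u hF (by rintro _ ⟨p, rfl⟩; exact h _ _) hf

theorem cell_eq_zero {k : ℕ} {s : S} (h : R.r k s ≠ s) : R.cell k s = 0 := by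
  ext x
  rw [cell_apply, if_neg]
  · rfl
  · rintro rfl
    exact h (R.r_r_of_le x le_rfl)

theorem cell_mul_cell_of_le {k l : ℕ} (h : k ≤ l) (s t : S) :
    R.cell k s * R.cell l t ∈ R.space := by
  have : R.cell k s * R.cell l t = (if R.r k t = s then 1 else 0 : ℂ) • R.cell l t := by
    ext x
    rw [lp.infty_coeFn_mul, lp.coeFn_smul, Pi.mul_apply, Pi.smul_apply, smul_eq_mul]
    simp only [cell_apply]
    by_cases hx : R.r l x = t
    · rw [← hx, R.r_r_of_le x h]
    · simp [hx]
  rw [this]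
  exact R.space.smul_mem _ (R.cell_mem_space l t)

theorem mul_mem_space {f g : LInf S} (hf : f ∈ R.space) (hg : g ∈ R.space) :
    f * g ∈ R.space := by
  refine R.map_mem_of_mem_space (ContinuousLinearMap.mul ℂ (LInf S) f) R.isClosed_space
    (fun l t => ?_) hg
  refine R.map_mem_of_mem_space ((ContinuousLinearMap.mul ℂ (LInf S)).flip (R.cell l t))
    R.isClosed_space (fun k s => ?_) hf
  rcases le_total k l with h | h
  · exact R.cell_mul_cell_of_le h s t
  · change R.cell k s * R.cell l t ∈ R.space
    rw [mul_comm]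
    exact R.cell_mul_cell_of_le h t s

/-- Cancellation makes the solution `u` of `r k t * u = s` unique, so a cell pulls back to a single
cell. -/
theorem pullback_mem_space [IsLeftCancelMul S] (t : S) {f : LInf S} (hf : f ∈ R.space) :
    pullback (t * ·) f ∈ R.space := by
  refine R.map_mem_of_mem_space _ R.isClosed_space (fun k s => ?_) hf
  by_cases h : ∃ u, R.r k t * u = s
  · obtain ⟨u, rfl⟩ := h
    convert R.cell_mem_space k u using 1
    ext x
    simp [cell_apply, R.map_mul]
  · convert R.space.zero_mem
    ext x
    rw [pullback_apply, cell_apply, R.map_mul, if_neg fun hx => h ⟨_, hx⟩]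
    rfl

/-- The cells over `s` converge pointwise to the indicator of `s`; hence the cells separate ℓ¹. -/
theorem tendsto_pairing_cell (a : L1 S) (s : S) :
    Filter.Tendsto (fun k => pairing S (R.cell k s) a) Filter.atTop (𝓝 (a s)) := by
  have := tendsto_tsum_of_dominated_convergence (𝓕 := Filter.atTop)
    (f := fun k x => R.cell k s x * a x) (g := fun x => if x = s then a x else 0)
    (summable_norm a) (fun x => ?_) (Filter.Eventually.of_forall fun k x => ?_)
  · simpa [pairing_apply] using this
  · refine tendsto_const_nhds.congr' ?_
    filter_upwards [R.eventually_r_eq_self x] with k hk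
    simp [cell_apply, hk]
  · rw [cell_apply]
    split_ifs <;> simp

theorem cell_eq_sum (k : ℕ) (s : S) :
    R.cell k s = ∑ t ∈ (R.finite_fiber k s).toFinset, R.cell (k + 1) t := by
  ext x
  rw [lp.coeFn_sum, Finset.sum_apply]
  simp only [cell_apply]
  rw [Finset.sum_ite_eq]
  simp [R.r_r_of_le]

/-- An additive function of the cells without point masses vanishes. -/
theorem eq_zero_of_tendsto_cell (ψ : R.space →L[ℂ] ℂ)
    (h : ∀ s, Filter.Tendsto (fun k => ψ ⟨R.cell k s, R.cell_mem_space k s⟩) Filter.atTop (𝓝 0)) :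
    ψ = 0 := by
  set b : ℕ → S → ℂ := fun k s => ψ ⟨R.cell k s, R.cell_mem_space k s⟩ with hb
  have hb0 {k s} (hs : R.r k s ≠ s) : b k s = 0 := by
    have : (⟨R.cell k s, R.cell_mem_space k s⟩ : R.space) = 0 := Subtype.ext (R.cell_eq_zero hs)
    simp only [hb, this]
    exact ψ.map_zero
  have hsum (k s) : b k s = ∑ t ∈ (R.finite_fiber k s).toFinset, b (k + 1) t := by
    have : (⟨R.cell k s, R.cell_mem_space k s⟩ : R.space) =
        ∑ t ∈ (R.finite_fiber k s).toFinset, ⟨R.cell (k + 1) t, R.cell_mem_space (k + 1) t⟩ :=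
      Subtype.ext (by rw [Submodule.coe_sum]; exact R.cell_eq_sum k s)
    simp only [hb, this]
    exact map_sum (ψ : R.space →ₗ[ℂ] ℂ) _ _
  -- When the cell over a fixed `s` is split, the pieces over `t ≠ s` have smaller rank and
  -- contribute zero. So `b k s` is constant in `k` from there on, and its limit is 0.
  have hzero (n : ℕ) : ∀ s, R.rank s = n → ∀ k, b k s = 0 := by
    induction n using Nat.strong_induction_on with
    | _ n ih =>
    intro s hs k
    by_cases hk : R.r k s = s
    · have hstep (l : ℕ) : b (k + l) s = b k s := by
        induction l with
        | zero => rfl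
        | succ l ihl =>
          have hkl : R.r (k + l) s = s := R.r_eq_self_of_le hk (Nat.le_add_right k l)
          rw [← ihl, hsum (k + l) s, Finset.sum_eq_single_of_mem s, add_assoc]
          · simp [hkl, R.r_eq_self_of_le hkl]
          · intro t ht hts
            obtain ⟨ht1, -⟩ : R.r (k + l) t = s ∧ _ := by simpa using ht
            have := R.rank_lt (k + l) t (by rw [ht1]; exact hts.symm)
            rw [ht1, hs] at this
            exact ih _ this t rfl _
      have h1 := (h s).comp (Filter.tendsto_add_atTop_nat k)
      refine tendsto_nhds_unique (tendsto_const_nhds.congr fun l => ?_) h1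
      rw [Function.comp_apply, add_comm l k]
      exact (hstep l).symm
    · exact hb0 hk
  ext ⟨f, hf⟩
  have hker : IsClosed
      ((LinearMap.ker (ψ : R.space →ₗ[ℂ] ℂ)).map R.space.subtype : Set (LInf S)) := by
    rw [Submodule.map_coe]
    exact R.isClosed_space.isClosedEmbedding_subtypeVal.isClosedMap _ ψ.isClosed_ker
  obtain ⟨g, hg, hgf⟩ := R.map_mem_of_mem_space (ContinuousLinearMap.id ℂ (LInf S)) hker
    (fun k s => ⟨⟨R.cell k s, R.cell_mem_space k s⟩, hzero _ s rfl k, rfl⟩) hf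
  obtain rfl : g = ⟨f, hf⟩ := Subtype.ext hgf
  exact hg

theorem sum_norm_cell_le_one (k : ℕ) (F : Finset S) (x : S) :
    ∑ s ∈ F, ‖R.cell k s x‖ ≤ 1 := by
  have (s : S) : ‖R.cell k s x‖ = if R.r k x = s then 1 else 0 := by
    rw [cell_apply]
    split_ifs <;> simp
  simp only [this]
  rw [Finset.sum_ite_eq]
  split_ifs <;> simp

theorem sum_norm_cell_sub_cell_le_one {k : ℕ} {s : S} (hs : R.r k s = s) (n : ℕ) (x : S) :
    ∑ i ∈ Finset.range n, ‖(R.cell (k + i) s - R.cell (k + (i + 1)) s : LInf S) x‖ ≤ 1 := by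
  set u : ℕ → ℝ := fun i => if R.r (k + i) x = s then 1 else 0 with hu
  have hstep (i : ℕ) : ‖(R.cell (k + i) s - R.cell (k + (i + 1)) s : LInf S) x‖
      = u i - u (i + 1) := by
    rw [lp.coeFn_sub, Pi.sub_apply, cell_apply, cell_apply]
    simp only [hu]
    by_cases h : R.r (k + (i + 1)) x = s
    · have : R.r (k + i) x = s := by
        rw [← R.r_r_of_le x (show k + i ≤ k + (i + 1) by omega), h]
        exact R.r_eq_self_of_le hs (Nat.le_add_right k i)
      simp [h, this]
    · simp only [h, if_false]
      split_ifs <;> simp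
  simp only [hstep]
  rw [Finset.sum_range_sub']
  simp only [hu]
  split_ifs <;> simp

/-- Once `s` is fixed its cells decrease, so successive differences are indicators of disjoint sets
and the variation of the values is at most `‖φ‖`. -/
theorem exists_tendsto_cell (φ : R.space →L[ℂ] ℂ) (s : S) :
    ∃ z, Filter.Tendsto (fun k => φ ⟨R.cell k s, R.cell_mem_space k s⟩) Filter.atTop (𝓝 z) := by
  obtain ⟨k, hk⟩ := R.exists_fixed s
  set c : ℕ → R.space := fun i => ⟨R.cell (k + i) s, R.cell_mem_space _ s⟩ with hc
  have hsum : Summable fun i => dist (φ (c i)) (φ (c i.succ)) := by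
    refine summable_of_sum_range_le (c := ‖φ‖) (fun _ => dist_nonneg) fun n => ?_
    have := sum_norm_apply_le φ (Finset.range n) (fun i => c i - c (i + 1))
      (R.sum_norm_cell_sub_cell_le_one hk n)
    refine le_trans (le_of_eq (Finset.sum_congr rfl fun i _ => ?_)) this
    rw [dist_eq_norm]
    exact congrArg _ (φ.map_sub _ _).symm
  obtain ⟨z, hz⟩ := cauchySeq_tendsto_of_complete (cauchySeq_of_summable_dist hsum)
  refine ⟨z, (Filter.tendsto_add_atTop_iff_nat k).1 (hz.congr fun i => ?_)⟩
  simp only [hc, add_comm]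

theorem isBanachPredual : IsBanachPredual R.space := by
  refine ⟨R.isClosed_space, fun a a' h => ?_, fun φ => ?_⟩
  · ext s
    refine tendsto_nhds_unique (R.tendsto_pairing_cell a s)
      ((R.tendsto_pairing_cell a' s).congr fun k => ?_)
    exact (DFunLike.congr_fun h ⟨R.cell k s, R.cell_mem_space k s⟩).symm
  · choose z hz using R.exists_tendsto_cell φ
    have hle (F : Finset S) : ∑ s ∈ F, ‖z s‖ ≤ ‖φ‖ :=
      le_of_tendsto (tendsto_finsetSum F fun s _ => (hz s).norm) (Filter.Eventually.of_forall
        fun k => sum_norm_apply_le φ F (fun s => ⟨R.cell k s, R.cell_mem_space k s⟩)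
          (R.sum_norm_cell_le_one k F))
    have hmem : Memℓp z 1 := memℓp_gen (by
      simpa using summable_of_sum_le (fun s => norm_nonneg (z s)) hle)
    refine ⟨⟨z, hmem⟩, sub_eq_zero.1 (R.eq_zero_of_tendsto_cell _ fun s => ?_)⟩
    have := (R.tendsto_pairing_cell ⟨z, hmem⟩ s).sub (hz s)
    rwa [sub_self] at this

end RetractionTower

theorem RetractionTower.isHopfPredual {S : Type*} [CommSemigroup S] [IsLeftCancelMul S]
    [DecidableEq S] (R : RetractionTower S) : IsHopfPredual R.space :=
  R.isBanachPredual.isHopfPredual (fun t _ => R.pullback_mem_space t)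
    fun _ hf _ => R.mul_mem_space hf

/-! ### Collapsing primes to 2 -/

/-- The prime `2`. -/
def primeTwo : Nat.Primes := ⟨2, Nat.prime_two⟩

open Classical in
/-- The map of primes which sends all primes of `A` beyond `k` to `2`. -/
noncomputable def collapse (A : Set Nat.Primes) (k : ℕ) (p : Nat.Primes) : Nat.Primes :=
  if p ∈ A ∧ k < p then primeTwo else p

theorem collapse_eq_self_of_le {A : Set Nat.Primes} {k : ℕ} {p : Nat.Primes} (h : (p : ℕ) ≤ k) :
    collapse A k p = p :=
  if_neg fun hp => absurd hp.2 h.not_gt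

theorem collapse_two (A : Set Nat.Primes) (k : ℕ) :
    collapse A k primeTwo = primeTwo := by
  simp [collapse]

theorem collapse_of_mem {A : Set Nat.Primes} {k : ℕ} {p : Nat.Primes} (hp : p ∈ A) (h : k < p) :
    collapse A k p = primeTwo :=
  if_pos ⟨hp, h⟩

theorem collapse_eq_two_or (A : Set Nat.Primes) (k : ℕ) (p : Nat.Primes) :
    collapse A k p = primeTwo ∨ collapse A k p = p := by
  unfold collapse
  split_ifs
  · exact .inl rfl
  · exact .inr rfl

theorem collapse_collapse_of_le (A : Set Nat.Primes) {k l : ℕ} (h : k ≤ l) (p : Nat.Primes) :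
    collapse A k (collapse A l p) = collapse A k p := by
  by_cases hp : p ∈ A ∧ l < p
  · rw [collapse_of_mem hp.1 hp.2, collapse_two, collapse_of_mem hp.1 (h.trans_lt hp.2)]
  · rw [show collapse A l p = p from if_neg hp]

theorem collapse_collapse_of_ge (A : Set Nat.Primes) {k l : ℕ} (h : k ≤ l) (p : Nat.Primes) :
    collapse A l (collapse A k p) = collapse A k p := by
  by_cases hp : p ∈ A ∧ k < p
  · rw [collapse_of_mem hp.1 hp.2, collapse_two]
  · rw [show collapse A k p = p from if_neg hp]
    exact if_neg fun hl => hp ⟨hl.1, h.trans_lt hl.2⟩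

/-- The primes of a positive integer, as a plain multiset. -/
def primeMultiset (n : ℕ+) : Multiset Nat.Primes := n.factorMultiset

theorem primeMultiset_mul (m n : ℕ+) :
    primeMultiset (m * n) = primeMultiset m + primeMultiset n :=
  PNat.factorMultiset_mul m n

theorem primeMultiset_injective : Function.Injective primeMultiset :=
  PNat.factorMultisetEquiv.injective

theorem primeMultiset_coe (p : Nat.Primes) : primeMultiset p = {p} :=
  PNat.factorMultiset_ofPrime p

/-- The endomorphism of `(ℕ, ·)` which replaces all prime factors in `A` beyond `k` by `2`. -/
noncomputable def collapseFactors (A : Set Nat.Primes) (k : ℕ) (n : ℕ+) : ℕ+ :=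
  PrimeMultiset.prod ((primeMultiset n).map (collapse A k))

theorem primeMultiset_collapseFactors (A : Set Nat.Primes) (k : ℕ) (n : ℕ+) :
    primeMultiset (collapseFactors A k n) = (primeMultiset n).map (collapse A k) :=
  PrimeMultiset.factorMultiset_prod _

theorem collapseFactors_coe (A : Set Nat.Primes) (k : ℕ) (p : Nat.Primes) :
    collapseFactors A k p = (collapse A k p : ℕ+) := by
  apply primeMultiset_injective
  rw [primeMultiset_collapseFactors, primeMultiset_coe, primeMultiset_coe, Multiset.map_singleton]

theorem collapseFactors_eq_self_iff (A : Set Nat.Primes) (k : ℕ) (n : ℕ+) :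
    collapseFactors A k n = n ↔ ∀ p ∈ primeMultiset n, collapse A k p = p := by
  rw [← primeMultiset_injective.eq_iff, primeMultiset_collapseFactors]
  refine ⟨fun h => ?_, fun h => ?_⟩
  · by_contra! hne
    obtain ⟨p, hp, hpk⟩ := hne
    have hp2 := (collapse_eq_two_or A k p).resolve_right hpk
    have hmem : p ∈ (primeMultiset n).map (collapse A k) := h.symm ▸ hp
    obtain ⟨q, -, rfl⟩ := Multiset.mem_map.1 hmem
    exact hpk (collapse_collapse_of_le A le_rfl q)
  · rw [Multiset.map_congr rfl h, Multiset.map_id']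

/-- Old factors 2 survive and every moved factor adds a new one. -/
theorem count_two_lt (A : Set Nat.Primes) (k : ℕ) (n : ℕ+) (h : collapseFactors A k n ≠ n) :
    (primeMultiset n).count primeTwo <
      (primeMultiset (collapseFactors A k n)).count primeTwo := by
  rw [Ne, collapseFactors_eq_self_iff] at h
  push Not at h
  obtain ⟨p, hp, hpk⟩ := h
  have hp2 := (collapse_eq_two_or A k p).resolve_right hpk
  rw [primeMultiset_collapseFactors, Multiset.count_map, Multiset.count,
    Multiset.countP_eq_card_filter]
  refine Multiset.card_lt_card (lt_of_le_of_ne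
    (Multiset.monotone_filter_right _ ?_) fun heq => ?_)
  · rintro _ rfl
    exact (collapse_two A k).symm
  · have : p ∈ (primeMultiset n).filter (fun q => primeTwo = collapse A k q) :=
      Multiset.mem_filter.2 ⟨hp, hp2.symm⟩
    rw [← heq, Multiset.mem_filter] at this
    exact hpk (this.2 ▸ collapse_two A k)

/-- Collapsing preserves the number of prime factors, and each prime of `t` is at most `k + 1` or
already divides `s`. -/
theorem finite_collapseFactors_fiber (A : Set Nat.Primes) (k : ℕ) (s : ℕ+) :
    {t | collapseFactors A k t = s ∧ collapseFactors A (k + 1) t = t}.Finite := by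
  set F : Finset Nat.Primes :=
    (primeMultiset s).toFinset ∪ (Set.Finite.toFinset (s := {p : Nat.Primes | (p : ℕ) ≤ k + 1})
      ((Set.finite_Iic (k + 1)).preimage Subtype.val_injective.injOn)) with hF
  have hfin : {m : Multiset Nat.Primes | m ≤ (primeMultiset s).card • F.val}.Finite :=
    (Multiset.finite_toSet (Multiset.powerset _)).subset fun m hm => Multiset.mem_powerset.2 hm
  refine (hfin.preimage primeMultiset_injective.injOn).subset ?_
  rintro t ⟨rfl, ht⟩
  rw [collapseFactors_eq_self_iff] at ht
  rw [Set.mem_preimage, Set.mem_ofPred_eq, Multiset.le_iff_count]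
  intro p
  by_cases hp : p ∈ primeMultiset t
  · have hpF : p ∈ F := by
      by_cases hpk : (p : ℕ) ≤ k + 1
      · exact Finset.mem_union_right _ ((Set.Finite.mem_toFinset _).2 hpk)
      · refine Finset.mem_union_left _ (Multiset.mem_toFinset.2 ?_)
        rw [primeMultiset_collapseFactors]
        refine Multiset.mem_map.2 ⟨p, hp, ?_⟩
        by_cases hpA : p ∈ A
        · have h2 := ht p hp
          rw [collapse_of_mem hpA (not_le.1 hpk)] at h2
          rw [← h2, collapse_two]
        · exact if_neg fun h => hpA h.1
    rw [Multiset.count_nsmul, Multiset.count_eq_one_of_mem F.nodup hpF, mul_one,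
      primeMultiset_collapseFactors, Multiset.card_map]
    exact Multiset.count_le_card _ _
  · rw [Multiset.count_eq_zero_of_notMem hp]
    exact Nat.zero_le _

/-- The tower of endomorphisms of `(ℕ, ·)` which makes the primes in `A` converge to `2`. -/
noncomputable def primeTower (A : Set Nat.Primes) : RetractionTower ℕ+ where
  r := collapseFactors A
  map_mul k x y := by
    apply primeMultiset_injective
    simp only [primeMultiset_collapseFactors, primeMultiset_mul, Multiset.map_add]
  r_r_of_le x h := by
    apply primeMultiset_injective
    simp only [primeMultiset_collapseFactors, Multiset.map_map, Function.comp_apply,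
      collapse_collapse_of_le A h]
  r_r_of_ge x h := by
    apply primeMultiset_injective
    simp only [primeMultiset_collapseFactors, Multiset.map_map, Function.comp_apply,
      collapse_collapse_of_ge A h]
  exists_fixed x := by
    obtain ⟨k, hk⟩ := ((primeMultiset x).toFinset.image fun p : Nat.Primes => (p : ℕ)).bddAbove
    refine ⟨k, (collapseFactors_eq_self_iff A k x).2 fun p hp => collapse_eq_self_of_le (hk ?_)⟩
    exact Finset.mem_coe.2 (Finset.mem_image_of_mem _ (Multiset.mem_toFinset.2 hp))
  rank n := (primeMultiset n).count primeTwo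
  rank_lt := count_two_lt A
  finite_fiber := finite_collapseFactors_fiber A

theorem primeTower_cell_coe (A : Set Nat.Primes) (k : ℕ) (s : ℕ+) (p : Nat.Primes) :
    (primeTower A).cell k s p = if (collapse A k p : ℕ+) = s then 1 else 0 := by
  rw [RetractionTower.cell_apply, ← collapseFactors_coe]
  rfl

/-! ### Distinguishing the preduals -/

/-- The functions in the space defined by `A` converge along `A` to their value at `2`; up to a
uniformly small error they are eventually constant. -/
theorem exists_finite_norm_sub_lt {A : Set Nat.Primes} {f : LInf ℕ+}
    (hf : f ∈ (primeTower A).space) {ε : ℝ} (hε : 0 < ε) :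
    {p | p ∈ A ∧ ε ≤ ‖f p - f primeTwo‖}.Finite := by
  have hspan : ∀ g ∈ Submodule.span ℂ (Set.range fun q : ℕ × ℕ+ => (primeTower A).cell q.1 q.2),
      {p : Nat.Primes | p ∈ A ∧ g p ≠ g primeTwo}.Finite := by
    intro g hg
    induction hg using Submodule.span_induction with
    | mem g hg =>
      obtain ⟨⟨k, s⟩, rfl⟩ := hg
      refine ((Set.finite_Iic k).preimage Subtype.val_injective.injOn).subset ?_
      rintro (p : Nat.Primes) ⟨hpA, hp⟩
      by_contra hpk
      refine hp ?_
      change (primeTower A).cell k s p = (primeTower A).cell k s primeTwo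
      rw [primeTower_cell_coe, primeTower_cell_coe, collapse_of_mem hpA (not_le.1 hpk), collapse_two]
    | zero => exact Set.finite_empty.subset fun p hp => hp.2 rfl
    | add g h _ _ ihg ihh =>
      refine (ihg.union ihh).subset ?_
      rintro p ⟨hpA, hp⟩
      by_contra hne
      simp only [Set.mem_union, Set.mem_ofPred_eq, not_or, not_and, not_not] at hne
      exact hp (by rw [lp.coeFn_add, Pi.add_apply, Pi.add_apply, hne.1 hpA, hne.2 hpA])
    | smul c g _ ih =>
      refine ih.subset ?_
      rintro p ⟨hpA, hp⟩
      exact ⟨hpA, fun h => hp (by rw [lp.coeFn_smul, Pi.smul_apply, Pi.smul_apply, h])⟩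
  obtain ⟨g, hg, hfg⟩ := Metric.mem_closure_iff.1 hf (ε / 2) (half_pos hε)
  refine (hspan g hg).subset ?_
  rintro p ⟨hpA, hp⟩
  refine ⟨hpA, fun h => hp.not_gt ?_⟩
  have hle (x : ℕ+) : ‖f x - g x‖ < ε / 2 := by
    rw [dist_eq_norm] at hfg
    exact (lp.norm_apply_le_norm (by simp) (f - g) x).trans_lt hfg
  calc ‖f p - f primeTwo‖ = ‖(f p - g p) - (f primeTwo - g primeTwo)‖ := by rw [h]; congr 1; ring
    _ ≤ ‖f p - g p‖ + ‖f primeTwo - g primeTwo‖ := norm_sub_le _ _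
    _ < ε / 2 + ε / 2 := add_lt_add (hle _) (hle _)
    _ = ε := add_halves ε

/-- The cell of `A` at level 0 over 2 is 1 at 2 but 0 at all other primes outside `A`; in the space
of `B` it must converge along `B` to 1. -/
theorem finite_diff_of_space_le {A B : Set Nat.Primes}
    (h : (primeTower A).space ≤ (primeTower B).space) : (B \ A).Finite := by
  have hfin := (exists_finite_norm_sub_lt
    (h ((primeTower A).cell_mem_space 0 (primeTwo : ℕ+))) one_pos).union
      (Set.finite_singleton primeTwo)
  refine hfin.subset ?_
  rintro p ⟨hpB, hpA⟩
  rcases eq_or_ne p primeTwo with rfl | hp2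
  · exact .inr rfl
  · refine .inl ⟨hpB, ?_⟩
    have hp : collapse A 0 p = p := if_neg fun h => hpA h.1
    have hne : (p : ℕ+) ≠ primeTwo := fun h => hp2 (Nat.Primes.coe_pnat_injective h)
    rw [primeTower_cell_coe, primeTower_cell_coe, hp, collapse_two, if_neg hne, if_pos rfl]
    simp

theorem exists_injective_primeTower_space :
    ∃ A : Set ℕ → Set Nat.Primes, Function.Injective fun X => (primeTower (A X)).space := by
  -- Each `n` is given infinitely many primes, so distinct `X` yield sets of primes with infinite
  -- difference.
  obtain ⟨e⟩ : Nonempty (ℕ × ℕ ≃ Nat.Primes) := nonempty_equiv_of_countable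
  refine ⟨fun X => {p | (e.symm p).1 ∈ X}, ?_⟩
  have hle {X Y : Set ℕ} (h : (primeTower {p | (e.symm p).1 ∈ X}).space ≤
      (primeTower {p | (e.symm p).1 ∈ Y}).space) : Y ⊆ X := by
    intro n hnY
    by_contra hnX
    refine (Set.infinite_of_injective_forall_mem (f := fun m => e (n, m)) (fun m m' hm => ?_)
      fun m => ?_) (finite_diff_of_space_le h)
    · simpa using hm
    · simp [hnY, hnX]
  exact fun X Y h => (hle h.ge).antisymm (hle h.le)

end SemigroupPredual

theorem mainTheorem6 :
    ∃ P : Set (Submodule ℂ (SemigroupPredual.LInf ℕ+)),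
      #P = 𝔠 ∧ ∀ E ∈ P, SemigroupPredual.IsHopfPredual E := by
  obtain ⟨A, hA⟩ := SemigroupPredual.exists_injective_primeTower_space
  refine ⟨Set.range fun X => (SemigroupPredual.primeTower (A X)).space, ?_, ?_⟩
  · rw [Cardinal.mk_range_eq _ hA, Cardinal.mk_set, Cardinal.mk_nat, Cardinal.two_power_aleph0]
  · rintro _ ⟨X, rfl⟩
    exact (SemigroupPredual.primeTower (A X)).isHopfPredual
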